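/- Let $R$ be an associative ring with identity, and let $\mathrm{Mod}\text{-}R$ be the class of unital right $R$-modules. For right $R$-modules $M,N$, say that $M$ is $N$-injective if for every submodule $K\le N$ every homomorphism $K\to M$ extends to a homomorphism $N\to M$. The injectivity domain of $M$ is the class $\mathfrak{In}^{-1}(M)=\{N\in\mathrm{Mod}\text{-}R : M\text{ is }N\text{-injective}\}$, and the (right) injective profile $i\mathcal{P}(R)=\{\mathfrak{In}^{-1}(M) : M\in\mathrm{Mod}\text{-}R\}$ is the collection of all injectivity domains, partially ordered by inclusion. Suppose that $R$ is a chain ring (its left ideals are linearly ordered by inclusion, and so are its right ideals), that $R$ is noetherian (left and right noetherian), and that $R$ is not artinian (not both left and right artinian). Then $i\mathcal{P}(R)$ is order-isomorphic to the ordinal $\omega+2$. In particular, $i\mathcal{P}(R)$ is linearly ordered but not finite. -/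

import Mathlib

universe u v w

/-- `M` is `N`-injective: every homomorphism from a submodule of `N` to `M` extends to `N`. -/
def IsInjectiveRelTo (S : Type u) [Ring S] (M : Type v) [AddCommGroup M] [Module S M]
    (N : Type w) [AddCommGroup N] [Module S N] : Prop :=
  ∀ (K : Submodule S N) (φ : K →ₗ[S] M), ∃ ψ : N →ₗ[S] M, ∀ x : K, ψ x = φ x

/-- The category `Mod-R` of right `R`-modules: these are the modules over the opposite ring. -/
abbrev RightMod (R : Type u) [Ring R] := ModuleCat.{u} Rᵐᵒᵖ

/-- The injectivity domain of the right module `M`: the class of all right modules `N`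
such that `M` is `N`-injective. -/
def injectivityDomain {R : Type u} [Ring R] (M : RightMod R) : Set (RightMod R) :=
  {N | IsInjectiveRelTo Rᵐᵒᵖ M N}

/-- The right injective profile of `R`: the collection of all injectivity domains of right
`R`-modules. It is partially ordered by inclusion. -/
def injectiveProfile (R : Type u) [Ring R] : Set (Set (RightMod R)) :=
  {A | ∃ M : RightMod R, A = injectivityDomain M}

/-- A (two-sided) chain ring: the left ideals are linearly ordered by inclusion, and so are
the right ideals. -/
def IsChainRing (R : Type u) [Ring R] : Prop :=
  (∀ I J : Submodule R R, I ≤ J ∨ J ≤ I) ∧ (∀ I J : Submodule Rᵐᵒᵖ R, I ≤ J ∨ J ≤ I)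

/-- A (two-sided) noetherian ring: left and right noetherian. -/
def IsTwoSidedNoetherian (R : Type u) [Ring R] : Prop :=
  IsNoetherian R R ∧ IsNoetherian Rᵐᵒᵖ R

/-- A (two-sided) artinian ring: left and right artinian. -/
def IsTwoSidedArtinian (R : Type u) [Ring R] : Prop :=
  IsArtinian R R ∧ IsArtinian Rᵐᵒᵖ R

/-!
A noetherian chain ring `R` that is not artinian is a noncommutative discrete valuation domain.
Its nonunits form both a left and a right ideal, each of them cyclic, and comparing the two
generators gives one element `p` with `p R = R p` the set of nonunits (`IsNonunitGenerator`). If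
`p` were nilpotent, there would be only finitely many one-sided ideals and `R` would be artinian.
Otherwise a Nakayama argument shows that no nonzero element is infinitely divisible by `p`
(`IsNonunitGenerator.exists_not_dvd`), so that `R` is a domain in which every nonzero element is a
unit times a power of `p` (`IsUniformizer`). This situation is left-right symmetric, so right
`R`-modules are treated as left modules over `S = Rᵐᵒᵖ`, which has a uniformizer as well.

Over such an `S`, a cyclic module is determined by the order of its generator (`annOrder`): the
least `n` such that `p ^ n` kills it, or `ω`. By Zorn's lemma, `M` is `N`-injective if and only if
it is injective relative to every cyclic submodule of `N`, which is a divisibility condition on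
`M` that depends only on the order `e` of an element of `N` and becomes stronger as `e` grows
(`IsUniformizer.isInjectiveRelTo_iff`). Each injectivity domain is therefore the class of modules
whose elements have order below some threshold. The condition always holds for `e ≤ 1`, so the
threshold is `2 + o` with `o < ω + 2`; here `2 + ω = ω` gives the modules in which every element
is killed by a power of `p`, and `2 + (ω + 1) = ω + 1` gives all modules. Each threshold occurs:
for `n ≥ 1`,
`S ⧸ S p ^ n` is injective relative to modules killed by `p ^ n` and no others; `S` is injective
exactly relative to torsion modules, which have no nonzero homomorphism to it; and the zero module
is injective. Cyclic modules show that different thresholds give different classes.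
-/

/-! ### Chain rings and generators of the nonunits -/

/-- In a noetherian module whose submodules are linearly ordered, every submodule is cyclic. -/
theorem exists_span_singleton_eq_of_total {S : Type*} [Ring S] {X : Type*} [AddCommGroup X]
    [Module S X] [IsNoetherian S X] (htot : ∀ I J : Submodule S X, I ≤ J ∨ J ≤ I)
    (K : Submodule S X) : ∃ x, Submodule.span S {x} = K := by
  refine Submodule.fg_induction (motive := fun K _ => ∃ x, Submodule.span S {x} = K)
    (fun x => ⟨x, rfl⟩) ?_ K (IsNoetherian.noetherian K)
  rintro _ _ - - ⟨x, rfl⟩ ⟨y, rfl⟩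
  rcases htot (.span S {x}) (.span S {y}) with h | h
  · exact ⟨y, (sup_eq_right.2 h).symm⟩
  · exact ⟨x, (sup_eq_left.2 h).symm⟩

/-- If `c * b = 1` and the left ideals are comparable, then one of the orthogonal idempotents
`b * c` and `1 - b * c` is a left multiple of the other, so one of them vanishes. -/
theorem isDedekindFiniteMonoid_of_total {R : Type*} [Ring R]
    (htot : ∀ I J : Submodule R R, I ≤ J ∨ J ≤ I) : IsDedekindFiniteMonoid R := by
  refine ⟨fun {c b} hcb => ?_⟩
  have hz : (1 - b * c) * b = 0 := by rw [sub_mul, mul_assoc, hcb]; simp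
  rcases htot (.span R {1 - b * c}) (.span R {b * c}) with h | h <;>
    obtain ⟨t, ht⟩ := Submodule.mem_span_singleton.1 (h (Submodule.mem_span_singleton_self _)) <;>
    rw [smul_eq_mul] at ht
  · have htb : t * b = 0 := by
      calc t * b = t * (b * c) * b := by rw [mul_assoc, mul_assoc, hcb, mul_one]
        _ = 0 := by rw [ht, hz]
    rw [← mul_assoc, htb, zero_mul] at ht
    exact (sub_eq_zero.1 ht.symm).symm
  · have hb : b = 0 := by
      calc b = b * c * b := by rw [mul_assoc, hcb, mul_one]
        _ = 0 := by rw [← ht, mul_assoc, hz, mul_zero]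
    have h01 : (0 : R) = 1 := by simpa [hb] using hcb
    exact (subsingleton_of_zero_eq_one h01).elim _ _

theorem not_isUnit_mul_left {R : Type*} [Monoid R] [IsDedekindFiniteMonoid R] {r s : R}
    (hs : ¬ IsUnit s) : ¬ IsUnit (r * s) := fun h => by
  obtain ⟨t, ht⟩ := isUnit_iff_exists_inv'.1 h
  exact hs (isUnit_iff_exists_inv'.2 ⟨t * r, by rw [mul_assoc, ht]⟩)

theorem not_isUnit_mul_right {R : Type*} [Monoid R] [IsDedekindFiniteMonoid R] {r s : R}
    (hs : ¬ IsUnit s) : ¬ IsUnit (s * r) := fun h => by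
  obtain ⟨t, ht⟩ := isUnit_iff_exists_inv.1 h
  exact hs (isUnit_iff_exists_inv.2 ⟨r * t, by rw [← mul_assoc, ht]⟩)

/-- The nonunits of `R` are exactly the left multiples of `p`, and also exactly its right
multiples. In a division ring this holds for `p = 0`. -/
structure IsNonunitGenerator {R : Type*} [Ring R] (p : R) : Prop where
  not_isUnit_iff_left : ∀ a, ¬ IsUnit a ↔ ∃ b, a = b * p
  not_isUnit_iff_right : ∀ a, ¬ IsUnit a ↔ ∃ b, a = p * b

theorem not_isUnit_add_of_total {R : Type*} [Ring R]
    (htot : ∀ I J : Submodule R R, I ≤ J ∨ J ≤ I) {a b : R} (ha : ¬ IsUnit a)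
    (hb : ¬ IsUnit b) : ¬ IsUnit (a + b) := by
  have := isDedekindFiniteMonoid_of_total htot
  rcases htot (.span R {a}) (.span R {b}) with h | h <;>
    obtain ⟨t, rfl⟩ := Submodule.mem_span_singleton.1 (h (Submodule.mem_span_singleton_self _)) <;>
    rw [smul_eq_mul]
  · simpa [add_mul] using not_isUnit_mul_left (r := t + 1) hb
  · simpa [add_mul] using not_isUnit_mul_left (r := 1 + t) ha

/-- The nonunits form a left and a right ideal, so they are `R q` and `p R` for some `p`, `q`.
Writing `q = p v`, either `v` is a unit, and then `p R = q R`, or `q = 0`. -/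
theorem exists_isNonunitGenerator {R : Type*} [Ring R] [Nontrivial R]
    [IsNoetherian R R] [IsNoetherian Rᵐᵒᵖ R]
    (hl : ∀ I J : Submodule R R, I ≤ J ∨ J ≤ I)
    (hr : ∀ I J : Submodule Rᵐᵒᵖ R, I ≤ J ∨ J ≤ I) : ∃ p : R, IsNonunitGenerator p := by
  have := isDedekindFiniteMonoid_of_total hl
  let J : Submodule R R :=
    { carrier := {a | ¬ IsUnit a}
      add_mem' := not_isUnit_add_of_total hl
      zero_mem' := by simp
      smul_mem' := fun _ _ h => not_isUnit_mul_left h }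
  let J' : Submodule Rᵐᵒᵖ R :=
    { carrier := {a | ¬ IsUnit a}
      add_mem' := not_isUnit_add_of_total hl
      zero_mem' := by simp
      smul_mem' := fun _ _ h => not_isUnit_mul_right h }
  obtain ⟨q, hq⟩ := exists_span_singleton_eq_of_total hl J
  obtain ⟨p, hp⟩ := exists_span_singleton_eq_of_total hr J'
  have hq' : ∀ a, ¬ IsUnit a ↔ ∃ b, a = b * q := fun a => by
    change a ∈ J ↔ _
    simp [← hq, Submodule.mem_span_singleton, eq_comm]
  have hp' : ∀ a, ¬ IsUnit a ↔ ∃ b, a = p * b := fun a => by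
    change a ∈ J' ↔ _
    rw [← hp, Submodule.mem_span_singleton]
    exact ⟨fun ⟨c, hc⟩ => ⟨c.unop, hc.symm⟩, fun ⟨c, hc⟩ => ⟨.op c, hc.symm⟩⟩
  have hpJ : ¬ IsUnit p := (hp' p).2 ⟨1, by simp⟩
  have hqJ : ¬ IsUnit q := (hq' q).2 ⟨1, by simp⟩
  refine ⟨q, hq', fun a => ⟨fun ha => ?_, ?_⟩⟩
  · obtain ⟨v, hv⟩ := (hp' q).1 hqJ
    by_cases hvu : IsUnit v
    · obtain ⟨v, rfl⟩ := hvu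
      obtain ⟨b, rfl⟩ := (hp' a).1 ha
      exact ⟨↑v⁻¹ * b, by rw [hv, mul_assoc, Units.mul_inv_cancel_left]⟩
    · -- `q = p * w * q` with `1 - p * w` invertible forces `q = 0`.
      obtain ⟨w, hw⟩ := (hq' v).1 hvu
      have hu : IsUnit (1 - p * w) := by
        by_contra hn
        exact not_isUnit_add_of_total hl hn (not_isUnit_mul_right (r := w) hpJ) (by simp)
      have hq0 : q = 0 := by
        refine (hu.mul_right_eq_zero).1 ?_
        rw [sub_mul, one_mul, mul_assoc, ← hw, ← hv, sub_self]
      obtain ⟨b, rfl⟩ := (hq' a).1 ha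
      exact ⟨0, by simp [hq0]⟩
  · rintro ⟨b, rfl⟩
    exact not_isUnit_mul_right hqJ

namespace IsNonunitGenerator

variable {R : Type*} [Ring R] {p : R}

theorem op (h : IsNonunitGenerator p) : IsNonunitGenerator (MulOpposite.op p) where
  not_isUnit_iff_left a := by
    rw [← isUnit_unop, h.not_isUnit_iff_right]
    exact ⟨fun ⟨b, hb⟩ => ⟨.op b, MulOpposite.unop_injective hb⟩,
      fun ⟨b, hb⟩ => ⟨b.unop, congrArg MulOpposite.unop hb⟩⟩
  not_isUnit_iff_right a := by
    rw [← isUnit_unop, h.not_isUnit_iff_left]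
    exact ⟨fun ⟨b, hb⟩ => ⟨.op b, MulOpposite.unop_injective hb⟩,
      fun ⟨b, hb⟩ => ⟨b.unop, congrArg MulOpposite.unop hb⟩⟩

theorem not_isUnit (h : IsNonunitGenerator p) : ¬ IsUnit p :=
  (h.not_isUnit_iff_left p).2 ⟨1, by simp⟩

theorem exists_mul_eq (h : IsNonunitGenerator p) (r : R) : ∃ r', p * r = r' * p :=
  (h.not_isUnit_iff_left _).1 ((h.not_isUnit_iff_right _).2 ⟨r, rfl⟩)

theorem exists_pow_mul_eq (h : IsNonunitGenerator p) (n : ℕ) (r : R) :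
    ∃ r', p ^ n * r = r' * p ^ n := by
  induction n with
  | zero => exact ⟨r, by simp⟩
  | succ n ih =>
    obtain ⟨s, hs⟩ := ih
    obtain ⟨t, ht⟩ := h.exists_mul_eq s
    exact ⟨t, by rw [pow_succ', mul_assoc, hs, ← mul_assoc, ht, mul_assoc]⟩

theorem exists_mul_pow_eq (h : IsNonunitGenerator p) (n : ℕ) (r : R) :
    ∃ r', r * p ^ n = p ^ n * r' := by
  obtain ⟨s, hs⟩ := h.op.exists_pow_mul_eq n (.op r)
  exact ⟨s.unop, by simpa using congrArg MulOpposite.unop hs⟩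

theorem isUnit_sub_mul (h : IsNonunitGenerator p) {v : R} (hv : IsUnit v) (w : R) :
    IsUnit (v - p * w) := by
  by_contra hn
  obtain ⟨c, hc⟩ := (h.not_isUnit_iff_right _).1 hn
  exact (h.not_isUnit_iff_right v).2 ⟨c + w, by rw [mul_add, ← hc, sub_add_cancel]⟩ hv

/-- Conjugation by a nonzero power of `p` preserves units. -/
theorem isUnit_of_pow_mul_eq (h : IsNonunitGenerator p) {n : ℕ} (hn : p ^ n ≠ 0) {v v' : R}
    (hv : IsUnit v) (he : p ^ n * v = v' * p ^ n) : IsUnit v' := by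
  by_contra hv'
  obtain ⟨w, rfl⟩ := (h.not_isUnit_iff_right _).1 hv'
  obtain ⟨t, ht⟩ := h.exists_mul_pow_eq n (p * w)
  obtain ⟨w', hw'⟩ := h.exists_mul_pow_eq n w
  have h0 : p ^ n * (v - p * w') = 0 := by
    rw [mul_sub, he, ← mul_assoc (p ^ n), ← pow_succ, pow_succ', mul_assoc p, mul_assoc p, hw',
      sub_self]
  exact hn ((h.isUnit_sub_mul hv w').mul_left_eq_zero.1 h0)

/-- An element that is not a left multiple of `p ^ m` is a unit times a smaller power of `p`. -/
theorem exists_unit_mul_pow_of_not_dvd (h : IsNonunitGenerator p) {a : R} {m : ℕ}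
    (ha : ∀ c, a ≠ c * p ^ m) : ∃ n < m, ∃ u : Rˣ, a = u * p ^ n := by
  induction m with
  | zero => exact absurd (by simp) (ha a)
  | succ m ih =>
    by_cases hm : ∀ c, a ≠ c * p ^ m
    · obtain ⟨n, hn, hu⟩ := ih hm
      exact ⟨n, hn.trans (Nat.lt_succ_self m), hu⟩
    · push Not at hm
      obtain ⟨c, rfl⟩ := hm
      by_cases hc : IsUnit c
      · exact ⟨m, Nat.lt_succ_self m, hc.unit, rfl⟩
      · obtain ⟨b, rfl⟩ := (h.not_isUnit_iff_left c).1 hc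
        exact absurd (by rw [pow_succ', mul_assoc]) (ha b)

theorem exists_pow_mul_unit_of_not_dvd (h : IsNonunitGenerator p) {a : R} {m : ℕ}
    (ha : ∀ c, a ≠ p ^ m * c) : ∃ n < m, ∃ u : Rˣ, a = p ^ n * u := by
  obtain ⟨n, hn, u, hu⟩ := h.op.exists_unit_mul_pow_of_not_dvd (a := .op a) (m := m)
    fun c hc => ha c.unop (by simpa using congrArg MulOpposite.unop hc)
  exact ⟨n, hn, (Units.opEquiv u).unop, by simpa using congrArg MulOpposite.unop hu⟩

/-- If `p ^ m = 0`, then the left ideals are the `R p ^ k` with `k ≤ m`, finitely many. -/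
theorem isArtinian_left_of_pow_eq_zero (h : IsNonunitGenerator p) [IsNoetherian R R]
    (hl : ∀ I J : Submodule R R, I ≤ J ∨ J ≤ I) {m : ℕ} (hm : p ^ m = 0) : IsArtinian R R := by
  have hsurj : Function.Surjective
      fun k : Fin (m + 1) => (Submodule.span R {p ^ (k : ℕ)} : Submodule R R) := fun K => by
    obtain ⟨a, rfl⟩ := exists_span_singleton_eq_of_total hl K
    by_cases ha : a = 0
    · exact ⟨Fin.last m, by simp [hm, ha]⟩
    · obtain ⟨n, hn, u, rfl⟩ := h.exists_unit_mul_pow_of_not_dvd (a := a) (m := m)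
        fun c hc => ha (by rw [hc, hm, mul_zero])
      exact ⟨⟨n, by omega⟩, (Submodule.span_singleton_group_smul_eq R u (p ^ n)).symm⟩
  have := Finite.of_surjective _ hsurj
  exact Finite.to_wellFoundedLT

theorem isArtinian_right_of_pow_eq_zero (h : IsNonunitGenerator p) [IsNoetherian Rᵐᵒᵖ R]
    (hr : ∀ I J : Submodule Rᵐᵒᵖ R, I ≤ J ∨ J ≤ I) {m : ℕ} (hm : p ^ m = 0) :
    IsArtinian Rᵐᵒᵖ R := by
  have hsurj : Function.Surjective
      fun k : Fin (m + 1) => (Submodule.span Rᵐᵒᵖ {p ^ (k : ℕ)} : Submodule Rᵐᵒᵖ R) := fun K => by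
    obtain ⟨a, rfl⟩ := exists_span_singleton_eq_of_total hr K
    by_cases ha : a = 0
    · exact ⟨Fin.last m, by simp [hm, ha]⟩
    · obtain ⟨n, hn, u, rfl⟩ := h.exists_pow_mul_unit_of_not_dvd (a := a) (m := m)
        fun c hc => ha (by rw [hc, hm, zero_mul])
      exact ⟨⟨n, by omega⟩,
        (Submodule.span_singleton_group_smul_eq Rᵐᵒᵖ (Units.opEquiv.symm (.op u)) (p ^ n)).symm⟩
  have := Finite.of_surjective _ hsurj
  exact Finite.to_wellFoundedLT

/-- A generator of the nonunits that is not nilpotent has no nonzero infinitely divisible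
element: the infinitely divisible elements form a left ideal `I = R a` with `p I = I`, and
`a = p r a` forces `a = 0`, as in Nakayama's lemma. -/
theorem exists_not_dvd (h : IsNonunitGenerator p) [IsNoetherian R R]
    (hl : ∀ I J : Submodule R R, I ≤ J ∨ J ≤ I) (hp : ∀ n, p ^ n ≠ 0) {x : R} (hx : x ≠ 0) :
    ∃ m, ∀ c, x ≠ c * p ^ m := by
  let I : Submodule R R := ⨅ n : ℕ, .span R {p ^ n}
  have hI : ∀ y, y ∈ I ↔ ∀ n, ∃ c, c * p ^ n = y := by
    simp [I, Submodule.mem_iInf, Submodule.mem_span_singleton]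
  obtain ⟨a, ha⟩ := exists_span_singleton_eq_of_total hl I
  have haI : a ∈ I := ha ▸ Submodule.mem_span_singleton_self a
  have ha0 : a = 0 := by
    obtain ⟨c, hc⟩ := (hI a).1 haI 1
    obtain ⟨y, hy⟩ := h.exists_mul_pow_eq 1 c
    rw [hc, pow_one] at hy
    have hyI : y ∈ I := by
      by_contra hyI
      rw [hI] at hyI
      push Not at hyI
      obtain ⟨m, hm⟩ := hyI
      obtain ⟨n, -, u, hu⟩ := h.exists_unit_mul_pow_of_not_dvd (a := y) (m := m)
        fun c hc => hm c hc.symm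
      -- Otherwise `a = p * y` is a unit times `p ^ (n + 1)`, so `p ^ (n + 2)` does not divide it.
      obtain ⟨u', hu'⟩ := h.exists_mul_eq u
      have huu : IsUnit u' :=
        h.isUnit_of_pow_mul_eq (n := 1) (hp 1) u.isUnit (by simpa using hu')
      obtain ⟨t, ht⟩ := (hI a).1 haI (n + 2)
      obtain ⟨t', ht'⟩ := h.exists_mul_pow_eq 1 t
      rw [pow_one] at ht'
      have h0 : (u' - p * t') * p ^ (n + 1) = 0 := by
        rw [sub_mul, ← ht', mul_assoc, ← pow_succ', ht, hy, hu, ← mul_assoc p, hu', mul_assoc,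
          ← pow_succ', sub_self]
      exact hp _ ((h.isUnit_sub_mul huu t').mul_right_eq_zero.1 h0)
    obtain ⟨r, hr⟩ := Submodule.mem_span_singleton.1 (ha.symm ▸ hyI)
    refine (h.isUnit_sub_mul isUnit_one r).mul_right_eq_zero.1 ?_
    rw [sub_mul, one_mul, mul_assoc, ← smul_eq_mul r, hr, ← hy, sub_self]
  by_contra! hcon
  have : x ∈ I := (hI x).2 fun n => (hcon n).imp fun _ h => h.symm
  rw [← ha, ha0] at this
  exact hx (by simpa using this)

end IsNonunitGenerator

/-- `p` is a uniformizer of a (noncommutative) discrete valuation domain: a normal regular nonunit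
such that every nonzero element is a unit times a power of `p`. -/
structure IsUniformizer {S : Type*} [Ring S] (p : S) : Prop where
  ne_zero : p ≠ 0
  not_isUnit : ¬ IsUnit p
  noZeroDivisors : NoZeroDivisors S
  exists_pow_mul_eq : ∀ (n : ℕ) r, ∃ r', p ^ n * r = r' * p ^ n
  exists_mul_pow_eq : ∀ (n : ℕ) r, ∃ r', r * p ^ n = p ^ n * r'
  exists_unit_mul_pow : ∀ a, a ≠ 0 → ∃ (n : ℕ) (u : Sˣ), a = u * p ^ n

theorem IsNonunitGenerator.isUniformizer {R : Type*} [Ring R] {p : R}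
    (h : IsNonunitGenerator p) [IsNoetherian R R]
    (hl : ∀ I J : Submodule R R, I ≤ J ∨ J ≤ I) (hp : ∀ n, p ^ n ≠ 0) : IsUniformizer p := by
  have hfac : ∀ a : R, a ≠ 0 → ∃ (n : ℕ) (u : Rˣ), a = u * p ^ n := fun a ha => by
    obtain ⟨m, hm⟩ := h.exists_not_dvd hl hp ha
    obtain ⟨n, -, u, hu⟩ := h.exists_unit_mul_pow_of_not_dvd hm
    exact ⟨n, u, hu⟩
  refine ⟨by simpa using hp 1, h.not_isUnit, ⟨fun {a b} hab => ?_⟩, h.exists_pow_mul_eq, h.exists_mul_pow_eq, hfac⟩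
  by_contra! hne
  obtain ⟨n, u, rfl⟩ := hfac a hne.1
  obtain ⟨m, v, rfl⟩ := hfac b hne.2
  obtain ⟨v', hv'⟩ := h.exists_pow_mul_eq n v
  have hu : IsUnit (u * v') := u.isUnit.mul (h.isUnit_of_pow_mul_eq (hp n) v.isUnit hv')
  refine hp (n + m) (hu.mul_right_eq_zero.1 ?_)
  rw [← hab, mul_assoc, mul_assoc (u : R), pow_add, ← mul_assoc (p ^ n), hv']
  simp only [mul_assoc]

/-- The ring opposite to a noetherian chain ring that is not artinian has a uniformizer. -/
theorem exists_isUniformizer_op {R : Type*} [Ring R] (hchain : IsChainRing R)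
    (hnoeth : IsTwoSidedNoetherian R) (hart : ¬ IsTwoSidedArtinian R) :
    ∃ p : Rᵐᵒᵖ, IsUniformizer p := by
  obtain ⟨hl, hr⟩ := hchain
  obtain ⟨hnl, hnr⟩ := hnoeth
  have : Nontrivial R := by
    by_contra hn
    rw [not_nontrivial_iff_subsingleton] at hn
    exact hart ⟨inferInstance, inferInstance⟩
  obtain ⟨p, h⟩ := exists_isNonunitGenerator hl hr
  have hp : ∀ n, p ^ n ≠ 0 := fun n hn => hart
    ⟨h.isArtinian_left_of_pow_eq_zero hl hn, h.isArtinian_right_of_pow_eq_zero hr hn⟩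
  have := (h.isUniformizer hl hp).noZeroDivisors
  refine ⟨.op p, by simpa using hp 1, h.op.not_isUnit, inferInstance, h.op.exists_pow_mul_eq,
    h.op.exists_mul_pow_eq, fun a ha => ?_⟩
  obtain ⟨m, hm⟩ := h.exists_not_dvd hl hp (x := a.unop) (by simpa using ha)
  obtain ⟨n, -, u, hu⟩ := h.exists_pow_mul_unit_of_not_dvd (a := a.unop) (m := m) fun c hc => by
    obtain ⟨c', hc'⟩ := h.exists_pow_mul_eq m c
    exact hm c' (hc.trans hc')
  exact ⟨n, Units.opEquiv.symm (.op u), MulOpposite.unop_injective (by simpa using hu)⟩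

/-! ### Relative injectivity by extension to one more element -/

theorem LinearPMap.apply_mk_eq_zero {S M N : Type*} [Ring S] [AddCommGroup M] [Module S M]
    [AddCommGroup N] [Module S N] (T : N →ₗ.[S] M) {a : N} (ha : a ∈ T.domain) (h0 : a = 0) :
    T ⟨a, ha⟩ = 0 := by
  subst h0
  exact T.map_zero

/-- A module is `N`-injective as soon as every partial map out of `N` extends to each further
element: the Zorn's lemma step of Baer's criterion. -/
theorem isInjectiveRelTo_of_extension {S : Type u} [Ring S] {M : Type v} [AddCommGroup M]
    [Module S M] {N : Type w} [AddCommGroup N] [Module S N]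
    (h : ∀ (T : N →ₗ.[S] M) (x : N),
      ∃ z : M, ∀ (c : S) (hc : c • x ∈ T.domain), T ⟨c • x, hc⟩ = c • z) :
    IsInjectiveRelTo S M N := by
  intro K φ
  obtain ⟨T, hφT, hT⟩ := zorn_le_nonempty_Ici₀ (LinearPMap.mk K φ)
    (fun C _ hC y hy => ⟨LinearPMap.sSup C hC.directedOn,
      fun _ hz => LinearPMap.le_sSup hC.directedOn hz⟩) _ le_rfl
  have htop : ∀ x, x ∈ T.domain := fun x => by
    obtain ⟨z, hz⟩ := h T x
    let g : N →ₗ.[S] M := LinearPMap.mkSpanSingleton' x z fun c hc => by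
      rw [RingHom.id_apply, ← hz c (by rw [hc]; exact T.domain.zero_mem)]
      exact T.apply_mk_eq_zero _ hc
    have hagree : ∀ (a : T.domain) (b : g.domain), (a : N) = b → T a = g b := by
      rintro ⟨a, ha⟩ ⟨b, hb⟩ rfl
      obtain ⟨c, rfl⟩ := Submodule.mem_span_singleton.1 hb
      exact (hz c ha).trans (LinearPMap.mkSpanSingleton'_apply x z _ c hb).symm
    have hle : T.sup g hagree ≤ T := hT (T.left_le_sup g hagree)
    exact hle.1 ((T.right_le_sup g hagree).1 (Submodule.mem_span_singleton_self x))
  refine ⟨T.toFun ∘ₗ LinearMap.codRestrict T.domain LinearMap.id htop, fun x => ?_⟩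
  exact (hφT.2 (x := x) (y := ⟨x, htop x⟩) rfl).symm

/-! ### The order of an element -/

open Classical in
/-- The order of `x` with respect to `p`: the least `n` with `p ^ n • x = 0`, or `ω` if no power of
`p` kills `x`. -/
noncomputable def annOrder {S : Type*} [Ring S] (p : S) {N : Type*} [AddCommGroup N] [Module S N]
    (x : N) : Ordinal.{0} :=
  if ∃ n : ℕ, p ^ n • x = 0 then ((sInf {n : ℕ | p ^ n • x = 0} : ℕ) : Ordinal.{0})
  else Ordinal.omega0

section annOrder

variable {S : Type*} [Ring S] (p : S) {N : Type*} [AddCommGroup N] [Module S N] (x : N)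

theorem annOrder_le_omega0 : annOrder p x ≤ Ordinal.omega0 := by
  unfold annOrder
  split_ifs
  · exact (Ordinal.natCast_lt_omega0 _).le
  · exact le_rfl

theorem annOrder_le_natCast_iff {n : ℕ} : annOrder p x ≤ n ↔ p ^ n • x = 0 := by
  unfold annOrder
  split_ifs with h
  · rw [Nat.cast_le]
    refine ⟨fun hn => ?_, fun hn => Nat.sInf_le hn⟩
    rw [← Nat.sub_add_cancel hn, pow_add, mul_smul, show p ^ sInf {n : ℕ | p ^ n • x = 0} • x = 0 from Nat.sInf_mem h,
      smul_zero]
  · exact ⟨fun hn => absurd hn (not_le.2 (Ordinal.natCast_lt_omega0 n)), fun hn => absurd ⟨n, hn⟩ h⟩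

end annOrder

/-! ### Relative injectivity over a ring with a uniformizer -/

/-- For `e = n`, every `y` killed by `p ^ (n - k)`, where `k ≤ n`, is divisible by `p ^ k`; for
`e = ω`, every element is divisible by every `p ^ k`. When `k > n` the truncated `n - k = 0` makes
the condition trivial. -/
def IsDivisibleUpTo {S : Type*} [Ring S] (p : S) (M : Type*) [AddCommGroup M] [Module S M]
    (e : Ordinal.{0}) : Prop :=
  ∀ (k : ℕ) (y : M), (∀ n : ℕ, e ≤ n → p ^ (n - k) • y = 0) → ∃ z : M, p ^ k • z = y

theorem IsDivisibleUpTo.mono {S : Type*} [Ring S] {p : S} {M : Type*} [AddCommGroup M]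
    [Module S M] {e e' : Ordinal.{0}} (h : IsDivisibleUpTo p M e) (hle : e' ≤ e) :
    IsDivisibleUpTo p M e' :=
  fun k y hy => h k y fun n hn => hy n (hle.trans hn)

theorem isDivisibleUpTo_one {S : Type*} [Ring S] (p : S) (M : Type*) [AddCommGroup M]
    [Module S M] : IsDivisibleUpTo p M 1 := by
  intro k y hy
  have h1 := hy 1 (by simp)
  rcases k with _ | k
  · exact ⟨y, by simp⟩
  · exact ⟨0, by simpa [eq_comm] using h1⟩

namespace IsUniformizer

variable {S : Type u} [Ring S] {p : S}

theorem mul_uniformizer_ne_one (h : IsUniformizer p) (a : S) : a * p ≠ 1 := fun ha => by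
  have := h.noZeroDivisors
  exact h.not_isUnit (isUnit_iff_exists_inv'.2 ⟨a, ha⟩)

theorem nontrivial (h : IsUniformizer p) : Nontrivial S := by
  by_contra hn
  rw [not_nontrivial_iff_subsingleton] at hn
  exact h.not_isUnit (isUnit_of_subsingleton p)

theorem pow_ne_zero (h : IsUniformizer p) (n : ℕ) : p ^ n ≠ 0 := by
  have := h.noZeroDivisors
  have := h.nontrivial
  exact _root_.pow_ne_zero n h.ne_zero

theorem uniformizer_mul_ne_one (h : IsUniformizer p) (a : S) : p * a ≠ 1 := fun ha => by
  have := h.noZeroDivisors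
  exact h.not_isUnit (isUnit_iff_exists_inv.2 ⟨a, ha⟩)

/-- Whether `M` is `N`-injective depends only on the orders of the elements of `N`, that is, on
its cyclic submodules. -/
theorem isInjectiveRelTo_iff (h : IsUniformizer p) (M : Type v) [AddCommGroup M] [Module S M]
    (N : Type w) [AddCommGroup N] [Module S N] :
    IsInjectiveRelTo S M N ↔ ∀ x : N, IsDivisibleUpTo p M (annOrder p x) := by
  constructor
  · intro hinj x k y hy
    simp only [annOrder_le_natCast_iff] at hy
    let g : N →ₗ.[S] M := LinearPMap.mkSpanSingleton' (p ^ k • x) y fun c hc => by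
      rw [RingHom.id_apply]
      by_cases hc0 : c = 0
      · rw [hc0, zero_smul]
      obtain ⟨m, u, rfl⟩ := h.exists_unit_mul_pow c hc0
      rw [mul_smul, smul_smul (p ^ m), ← pow_add, ← Units.smul_def, smul_eq_zero_iff_eq] at hc
      have := hy _ hc
      rw [Nat.add_sub_cancel] at this
      rw [mul_smul, this, smul_zero]
    obtain ⟨ψ, hψ⟩ := hinj g.domain g.toFun
    refine ⟨ψ x, ?_⟩
    have hmem : p ^ k • x ∈ g.domain := Submodule.mem_span_singleton_self _
    rw [← map_smul]
    exact (hψ ⟨_, hmem⟩).trans (LinearPMap.mkSpanSingleton'_apply_self _ _ _ hmem)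
  · refine fun hdiv => isInjectiveRelTo_of_extension fun T x => ?_
    by_cases hex : ∃ k, p ^ k • x ∈ T.domain
    · -- With `k` least such that `p ^ k • x` lies in the domain, dividing its image by `p ^ k`
      -- gives a value for `x`.
      classical
      have hk := Nat.find_spec hex
      have hmin : ∀ {m}, p ^ m • x ∈ T.domain → Nat.find hex ≤ m := fun hm => Nat.find_min' hex hm
      generalize Nat.find hex = k at hk hmin
      have hT : ∀ {m} (hm : p ^ m • x ∈ T.domain),
          T ⟨p ^ m • x, hm⟩ = p ^ (m - k) • T ⟨p ^ k • x, hk⟩ := fun {m} hm => by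
        rw [← T.map_smul]
        congr 1
        rw [SetLike.mk_smul_mk, Subtype.mk.injEq, smul_smul, ← pow_add,
          Nat.sub_add_cancel (hmin hm)]
      obtain ⟨z, hz⟩ := hdiv x k (T ⟨p ^ k • x, hk⟩) fun n hn => by
        rw [annOrder_le_natCast_iff] at hn
        rw [← hT (hn ▸ T.domain.zero_mem)]
        exact T.apply_mk_eq_zero _ hn
      refine ⟨z, fun c hc => ?_⟩
      by_cases hc0 : c = 0
      · rw [T.apply_mk_eq_zero hc (by rw [hc0, zero_smul]), hc0, zero_smul]
      obtain ⟨m, u, rfl⟩ := h.exists_unit_mul_pow c hc0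
      have hm : p ^ m • x ∈ T.domain := by
        have := T.domain.smul_mem (↑u⁻¹ : S) hc
        rwa [smul_smul, Units.inv_mul_cancel_left] at this
      have : T ⟨(u * p ^ m : S) • x, hc⟩ = (u : S) • T ⟨p ^ m • x, hm⟩ := by
        rw [← T.map_smul]
        congr 1
        rw [SetLike.mk_smul_mk, Subtype.mk.injEq, mul_smul]
      rw [this, hT hm, ← hz, smul_smul (p ^ _), ← pow_add, Nat.sub_add_cancel (hmin hm), mul_smul]
    · -- Only `0 • x` lies in the domain, so any value will do.
      refine ⟨0, fun c hc => ?_⟩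
      by_cases hc0 : c = 0
      · rw [T.apply_mk_eq_zero hc (by rw [hc0, zero_smul]), hc0, zero_smul]
      obtain ⟨m, u, rfl⟩ := h.exists_unit_mul_pow c hc0
      refine absurd ⟨m, ?_⟩ hex
      have := T.domain.smul_mem (↑u⁻¹ : S) hc
      rwa [smul_smul, Units.inv_mul_cancel_left] at this

/-! ### Cyclic modules -/

theorem isDivisibleUpTo_self_iff (h : IsUniformizer p) {e : Ordinal.{0}} :
    IsDivisibleUpTo p S e ↔ e < Ordinal.omega0 := by
  have := h.noZeroDivisors
  constructor
  · intro hd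
    by_contra! hle
    obtain ⟨z, hz⟩ := hd 1 1 fun n hn =>
      absurd (hle.trans hn) (not_le.2 (Ordinal.natCast_lt_omega0 n))
    exact h.uniformizer_mul_ne_one z (by simpa using hz)
  · intro he k y hy
    obtain ⟨n, rfl⟩ := Ordinal.lt_omega0.1 he
    have := (mul_eq_zero.1 (hy n le_rfl)).resolve_left (h.pow_ne_zero _)
    exact ⟨0, by simp [this]⟩

theorem isDivisibleUpTo_quotient_iff (h : IsUniformizer p) {n : ℕ} (hn : n ≠ 0)
    {e : Ordinal.{0}} :
    IsDivisibleUpTo p (S ⧸ (Submodule.span S {p ^ n} : Submodule S S)) e ↔ e ≤ n := by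
  have := h.noZeroDivisors
  constructor
  · intro hd
    -- The class of `1` is killed by `p ^ n` but is not divisible by `p`.
    by_contra! hlt
    obtain ⟨z, hz⟩ := hd 1 (Submodule.Quotient.mk 1) fun m hm => by
      have hnm : n + 1 ≤ m := by exact_mod_cast hlt.trans_le hm
      rw [← Submodule.Quotient.mk_smul, Submodule.Quotient.mk_eq_zero,
        Submodule.mem_span_singleton]
      exact ⟨p ^ (m - 1 - n), by rw [smul_eq_mul, ← pow_add]; simp; congr 1; omega⟩
    obtain ⟨r, rfl⟩ := Submodule.Quotient.mk_surjective _ z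
    rw [← Submodule.Quotient.mk_smul, Submodule.Quotient.eq, Submodule.mem_span_singleton] at hz
    obtain ⟨t, ht⟩ := hz
    obtain ⟨s, hs⟩ := h.exists_mul_pow_eq n t
    obtain ⟨n, rfl⟩ := Nat.exists_eq_succ_of_ne_zero hn
    rw [smul_eq_mul, hs, smul_eq_mul, pow_one, Nat.succ_eq_add_one, pow_succ', mul_assoc] at ht
    exact h.uniformizer_mul_ne_one (r - p ^ n * s) (by rw [mul_sub, ht, sub_sub_cancel])
  · refine fun he => IsDivisibleUpTo.mono (e := n) (fun k y hy => ?_) he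
    obtain ⟨r, rfl⟩ := Submodule.Quotient.mk_surjective _ y
    have hr := hy n le_rfl
    by_cases hkn : k ≤ n
    · rw [← Submodule.Quotient.mk_smul, Submodule.Quotient.mk_eq_zero,
        Submodule.mem_span_singleton] at hr
      obtain ⟨t, ht⟩ := hr
      obtain ⟨s, hs⟩ := h.exists_mul_pow_eq n t
      refine ⟨Submodule.Quotient.mk s, ?_⟩
      rw [← Submodule.Quotient.mk_smul]
      congr 1
      refine mul_left_cancel₀ (h.pow_ne_zero (n - k)) ?_
      rw [smul_eq_mul, ← mul_assoc, ← pow_add, Nat.sub_add_cancel hkn, ← hs]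
      exact ht
    · rw [Nat.sub_eq_zero_of_le (by omega), pow_zero, one_smul] at hr
      exact ⟨0, by rw [hr, smul_zero]⟩

theorem annOrder_one (h : IsUniformizer p) :
    annOrder p (1 : S) = Ordinal.omega0 := by
  refine (annOrder_le_omega0 p _).antisymm ?_
  by_contra! hlt
  obtain ⟨n, hn⟩ := Ordinal.lt_omega0.1 hlt
  have := (annOrder_le_natCast_iff p _).1 hn.le
  exact h.pow_ne_zero n (by simpa using this)

theorem annOrder_quotient_le (h : IsUniformizer p) (n : ℕ)
    (x : S ⧸ (Submodule.span S {p ^ n} : Submodule S S)) : annOrder p x ≤ n := by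
  obtain ⟨r, rfl⟩ := Submodule.Quotient.mk_surjective _ x
  obtain ⟨r', hr'⟩ := h.exists_pow_mul_eq n r
  rw [annOrder_le_natCast_iff, ← Submodule.Quotient.mk_smul, Submodule.Quotient.mk_eq_zero,
    Submodule.mem_span_singleton]
  exact ⟨r', hr'.symm⟩

theorem annOrder_quotient_mk_one (h : IsUniformizer p) (n : ℕ) :
    annOrder p (Submodule.Quotient.mk 1 : S ⧸ (Submodule.span S {p ^ n} : Submodule S S)) = n := by
  have := h.noZeroDivisors
  refine (h.annOrder_quotient_le n _).antisymm ?_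
  by_contra! hlt
  obtain ⟨m, hm⟩ := Ordinal.lt_omega0.1 (hlt.trans (Ordinal.natCast_lt_omega0 n))
  rw [hm, Nat.cast_lt] at hlt
  have hk := (annOrder_le_natCast_iff p _).1 hm.le
  rw [← Submodule.Quotient.mk_smul, Submodule.Quotient.mk_eq_zero, Submodule.mem_span_singleton]
    at hk
  obtain ⟨t, ht⟩ := hk
  obtain ⟨d, rfl⟩ := Nat.exists_eq_add_of_lt hlt
  refine h.mul_uniformizer_ne_one (t * p ^ d) (mul_right_cancel₀ (h.pow_ne_zero m) ?_)
  rw [one_mul, mul_assoc, mul_assoc, ← pow_succ', ← pow_add]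
  simpa [add_assoc, add_left_comm] using ht

end IsUniformizer

/-! ### The injective profile -/

section Profile

variable {S : Type u} [Ring S] {p : S}

/-- The modules all of whose elements have order less than `2 + o`. The shift by `2` accounts for
the fact that every module is injective relative to modules killed by `p`. -/
def orderClass (p : S) (o : Ordinal.{0}) : Set (ModuleCat.{u} S) :=
  {N | ∀ x : N, annOrder p x < 2 + o}

theorem two_add_le_omega0 {o : Ordinal.{0}} (h : o ≤ Ordinal.omega0) :
    2 + o ≤ Ordinal.omega0 :=
  (add_le_add_right h 2).trans (Ordinal.natCast_add_omega0 2).le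

/-- A cyclic module whose generator has order exactly `2 + o` separates the two classes. -/
theorem IsUniformizer.orderClass_ssubset (h : IsUniformizer p) {o o' : Ordinal.{0}} (hlt : o < o')
    (ho' : o' < Ordinal.omega0 + 2) : orderClass p o ⊂ orderClass p o' := by
  have hmono : 2 + o < 2 + o' := add_lt_add_right hlt 2
  have ho : o ≤ Ordinal.omega0 := by
    rw [← Order.lt_succ_iff]
    rw [← one_add_one_eq_two, ← add_assoc, ← Order.succ_eq_add_one, Order.lt_succ_iff] at ho'
    exact hlt.trans_le ho'
  refine Set.ssubset_iff_exists.2 ⟨fun N hN x => (hN x).trans hmono, ?_⟩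
  rcases (two_add_le_omega0 ho).lt_or_eq with hfin | hω
  · obtain ⟨n, hn⟩ := Ordinal.lt_omega0.1 hfin
    refine ⟨ModuleCat.of S (S ⧸ (Submodule.span S {p ^ n} : Submodule S S)), fun x => ?_,
      fun hN => ?_⟩
    · exact (h.annOrder_quotient_le n x).trans_lt (hn ▸ hmono)
    · exact (hN (Submodule.Quotient.mk 1)).ne ((h.annOrder_quotient_mk_one n).trans hn.symm)
  · refine ⟨ModuleCat.of S S, fun x => ?_, fun hN => ?_⟩
    · exact (annOrder_le_omega0 p x).trans_lt (hω ▸ hmono)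
    · exact (hN (1 : S)).ne (h.annOrder_one.trans hω.symm)

/-- Every threshold `2 + o` is attained: for `o = n` by the cyclic module `S ⧸ S p ^ (n + 1)`, for
`o = ω` by `S` itself, and beyond that by the zero module. -/
theorem IsUniformizer.exists_isDivisibleUpTo_iff (h : IsUniformizer p) (o : Ordinal.{0}) :
    ∃ M : ModuleCat.{u} S, ∀ e ≤ Ordinal.omega0, IsDivisibleUpTo p M e ↔ e < 2 + o := by
  rcases lt_trichotomy o Ordinal.omega0 with ho | rfl | ho
  · obtain ⟨n, rfl⟩ := Ordinal.lt_omega0.1 ho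
    refine ⟨ModuleCat.of S (S ⧸ (Submodule.span S {p ^ (n + 1)} : Submodule S S)), fun e _ => ?_⟩
    have h2 : (2 + n : Ordinal.{0}) = Order.succ ((n + 1 : ℕ) : Ordinal.{0}) := by
      rw [Order.succ_eq_add_one]
      norm_cast
      omega
    rw [h2, Order.lt_succ_iff]
    exact h.isDivisibleUpTo_quotient_iff n.succ_ne_zero
  · refine ⟨ModuleCat.of S S, fun e _ => ?_⟩
    rw [show (2 + Ordinal.omega0 : Ordinal.{0}) = _ from Ordinal.natCast_add_omega0 2]
    exact h.isDivisibleUpTo_self_iff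
  · refine ⟨ModuleCat.of S PUnit, fun e he => iff_of_true ?_ ?_⟩
    · exact fun k y _ => ⟨y, Subsingleton.elim (α := PUnit) _ _⟩
    · exact (he.trans_lt ho).trans_le le_add_self

/-- The orders up to which a module is divisible form an initial segment `e < 2 + o`. -/
theorem exists_isDivisibleUpTo_iff_lt (p : S) (M : Type v) [AddCommGroup M] [Module S M] :
    ∃ o < (Ordinal.omega0 + 2 : Ordinal.{0}), ∀ e ≤ Ordinal.omega0,
      IsDivisibleUpTo p M e ↔ e < 2 + o := by
  by_cases hω : IsDivisibleUpTo p M Ordinal.omega0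
  · refine ⟨Ordinal.omega0 + 1, by gcongr; exact one_lt_two, fun e he =>
      iff_of_true (hω.mono he) ?_⟩
    exact (he.trans_lt (lt_add_one _)).trans_le le_add_self
  · have hne : {e | ¬ IsDivisibleUpTo p M e}.Nonempty := ⟨_, hω⟩
    have hmem : ¬ IsDivisibleUpTo p M (sInf {e | ¬ IsDivisibleUpTo p M e}) := csInf_mem hne
    have hmin : ∀ {e}, e < sInf {e | ¬ IsDivisibleUpTo p M e} → IsDivisibleUpTo p M e :=
      fun he => not_not.1 (notMem_of_lt_csInf' he)
    generalize sInf {e | ¬ IsDivisibleUpTo p M e} = c at hmem hmin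
    have h2 : 2 ≤ c := by
      by_contra! hc
      rw [← one_add_one_eq_two, ← Order.succ_eq_add_one, Order.lt_succ_iff] at hc
      exact hmem ((isDivisibleUpTo_one p M).mono hc)
    have hcω : c ≤ Ordinal.omega0 := by
      by_contra! hc
      exact hω (hmin hc)
    refine ⟨c - 2, ?_, fun e _ => ?_⟩
    · exact ((Ordinal.sub_le_self c 2).trans hcω).trans_lt (lt_add_of_pos_right _ two_pos)
    · rw [Ordinal.add_sub_cancel_of_le h2]
      exact ⟨fun he => not_le.1 fun hc => hmem (he.mono hc), hmin⟩

end Profile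

theorem IsUniformizer.injectivityDomain_eq_orderClass {R : Type u} [Ring R] {p : Rᵐᵒᵖ}
    (h : IsUniformizer p) (M : RightMod R) {o : Ordinal.{0}}
    (hM : ∀ e ≤ Ordinal.omega0, IsDivisibleUpTo p M e ↔ e < 2 + o) :
    injectivityDomain M = orderClass p o := by
  ext N
  exact (h.isInjectiveRelTo_iff M N).trans
    (forall_congr' fun x => hM _ (annOrder_le_omega0 p x))

theorem IsUniformizer.nonempty_injectiveProfile_orderIso {R : Type u} [Ring R] {p : Rᵐᵒᵖ}
    (h : IsUniformizer p) :
    Nonempty (injectiveProfile R ≃o Set.Iio (Ordinal.omega0 + 2 : Ordinal.{0})) := by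
  let F : Set.Iio (Ordinal.omega0 + 2 : Ordinal.{0}) → injectiveProfile R := fun o =>
    ⟨orderClass p o.1, by
      obtain ⟨M, hM⟩ := h.exists_isDivisibleUpTo_iff o.1
      exact ⟨M, (h.injectivityDomain_eq_orderClass M hM).symm⟩⟩
  have hF : StrictMono F := fun o o' hlt => h.orderClass_ssubset hlt o'.2
  have hsurj : Function.Surjective F := by
    rintro ⟨_, M, rfl⟩
    obtain ⟨o, ho, hM⟩ := exists_isDivisibleUpTo_iff_lt p M
    exact ⟨⟨o, ho⟩, Subtype.ext (h.injectivityDomain_eq_orderClass M hM).symm⟩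
  exact ⟨(hF.orderIsoOfSurjective F hsurj).symm⟩

theorem proposition3p6 (R : Type u) [Ring R] (hchain : IsChainRing R)
    (hnoeth : IsTwoSidedNoetherian R) (hart : ¬ IsTwoSidedArtinian R) :
    Nonempty (injectiveProfile R ≃o Set.Iio (Ordinal.omega0 + 2 : Ordinal.{0})) ∧
      (∀ A ∈ injectiveProfile R, ∀ B ∈ injectiveProfile R, A ⊆ B ∨ B ⊆ A) ∧
      (injectiveProfile R).Infinite := by
  obtain ⟨p, hp⟩ := exists_isUniformizer_op hchain hnoeth hart
  obtain ⟨e⟩ := hp.nonempty_injectiveProfile_orderIso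
  refine ⟨⟨e⟩, fun A hA B hB => ?_, ?_⟩
  · exact (le_total (e ⟨A, hA⟩) (e ⟨B, hB⟩)).imp e.le_iff_le.1 e.le_iff_le.1
  · rw [← Set.infinite_coe_iff]
    refine Infinite.of_injective (fun n : ℕ => e.symm ⟨n, ?_⟩) fun m n hmn => ?_
    · exact (Ordinal.natCast_lt_omega0 n).trans_le le_self_add
    · exact Nat.cast_injective (Subtype.ext_iff.1 (e.symm.injective hmn))
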